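/- Let $(\Omega_1,\mu_1)$ and $(\Omega_2,\mu_2)$ be $\sigma$-finite measure spaces and let $E$ and $F$ be (real or complex, not necessarily separable) Hilbert spaces over the same scalar field. For Hilbert spaces $H_1,H_2$ let $\mathscr{L}_2(H_1,H_2)$ be the Hilbert space of Hilbert–Schmidt operators from $H_1$ to $H_2$, i.e. of the bounded linear operators $T$ with $\|T\|_{\mathscr{L}_2}^2=\sum_i\|Te_i\|^2<\infty$ for an (equivalently, every) orthonormal basis $(e_i)$ of $H_1$; and let $L^2(\Omega;X)$ be the Bochner space of (equivalence classes of) strongly measurable, square integrable functions with values in $X$. For every $k\in L^2(\Omega_1\times\Omega_2;\mathscr{L}_2(E,F))$ there is exactly one bounded linear operator $T_k\colon L^2(\Omega_1;E)\to L^2(\Omega_2;F)$ such that for all $f\in L^2(\Omega_1;E)$, all $v\in F$ and $\mu_2$-almost every $\omega_2\in\Omega_2$ the function $\omega_1\mapsto\langle k(\omega_1,\omega_2)f(\omega_1),v\rangle$ is $\mu_1$-integrable and \[ \langle (T_kf)(\omega_2),v\rangle=\int_{\Omega_1}\langle k(\omega_1,\omega_2)f(\omega_1),v\rangle\,\mathrm{d}\mu_1(\omega_1).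 \] The mapping $k\mapsto T_k$ is an isometric (linear) isomorphism from $L^2(\Omega_1\times\Omega_2;\mathscr{L}_2(E,F))$ onto $\mathscr{L}_2(L^2(\Omega_1;E),L^2(\Omega_2;F))$. In particular, \[ \|T_k\|_{\mathscr{L}_2}^2=\int_{\Omega_1\times\Omega_2}\|k(\omega_1,\omega_2)\|_{\mathscr{L}_2(E,F)}^2\,\mathrm{d}(\mu_1\otimes\mu_2)(\omega_1,\omega_2). \] -/

import Mathlib

open MeasureTheory

noncomputable section

section HilbertSchmidt

variable (𝕜 : Type*) [RCLike 𝕜]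
variable (E F : Type*) [NormedAddCommGroup E] [InnerProductSpace 𝕜 E] [CompleteSpace E]
  [NormedAddCommGroup F] [InnerProductSpace 𝕜 F]

/-- The index set of an (arbitrarily chosen) Hilbert basis of `E`. -/
def HSIndex : Set E := (exists_hilbertBasis 𝕜 E).choose

/-- An (arbitrarily chosen) Hilbert basis of `E`. The notions defined from it below do not depend
on this choice: see `isHilbertSchmidt_iff` and `HilbertSchmidt.hasSum_norm_sq`. -/
def hsBasis : HilbertBasis (HSIndex 𝕜 E) 𝕜 E := (exists_hilbertBasis 𝕜 E).choose_spec.choose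

variable {𝕜 E F}

/-- A bounded operator is Hilbert–Schmidt if `∑ i, ‖T eᵢ‖² < ∞` for an orthonormal basis `eᵢ`. -/
def IsHilbertSchmidt (T : E →L[𝕜] F) : Prop :=
  Summable fun i : HSIndex 𝕜 E => ‖T (hsBasis 𝕜 E i)‖ ^ 2

theorem isHilbertSchmidt_iff_memlp (T : E →L[𝕜] F) :
    IsHilbertSchmidt T ↔ Memℓp (fun i : HSIndex 𝕜 E => T (hsBasis 𝕜 E i)) 2 := by
  rw [memℓp_gen_iff (by simp), IsHilbertSchmidt]
  simp

variable (𝕜 E F)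

/-- The linear subspace of the Hilbert–Schmidt operators. -/
def hilbertSchmidtSubmodule : Submodule 𝕜 (E →L[𝕜] F) where
  carrier := {T | IsHilbertSchmidt T}
  zero_mem' := by simp [IsHilbertSchmidt, summable_zero]
  add_mem' := by
    intro S T hS hT
    rw [Set.mem_ofPred_eq, isHilbertSchmidt_iff_memlp] at *
    exact hS.add hT
  smul_mem' := by
    intro c T hT
    rw [Set.mem_ofPred_eq, isHilbertSchmidt_iff_memlp] at *
    exact hT.const_smul c

/-- The space `L₂(E, F)` of Hilbert–Schmidt operators from `E` to `F`. It is a type of its own,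
because it carries the Hilbert–Schmidt norm and not the operator norm. -/
def HilbertSchmidt : Type _ := hilbertSchmidtSubmodule 𝕜 E F

namespace HilbertSchmidt

instance : AddCommGroup (HilbertSchmidt 𝕜 E F) :=
  inferInstanceAs (AddCommGroup (hilbertSchmidtSubmodule 𝕜 E F))

instance : Module 𝕜 (HilbertSchmidt 𝕜 E F) :=
  inferInstanceAs (Module 𝕜 (hilbertSchmidtSubmodule 𝕜 E F))

variable {𝕜 E F}

/-- The bounded operator underlying an element of `L₂(E, F)`. -/
def toCLM : HilbertSchmidt 𝕜 E F →ₗ[𝕜] (E →L[𝕜] F) := (hilbertSchmidtSubmodule 𝕜 E F).subtype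

theorem toCLM_injective : Function.Injective (toCLM : HilbertSchmidt 𝕜 E F →ₗ[𝕜] (E →L[𝕜] F)) :=
  (hilbertSchmidtSubmodule 𝕜 E F).injective_subtype

theorem isHilbertSchmidt_toCLM (T : HilbertSchmidt 𝕜 E F) : IsHilbertSchmidt (toCLM T) :=
  Subtype.property (p := fun S => S ∈ hilbertSchmidtSubmodule 𝕜 E F) T

/-- The sequence `(T eᵢ)ᵢ` in `ℓ²`. -/
def toL2Seq : HilbertSchmidt 𝕜 E F →ₗ[𝕜] lp (fun _ : HSIndex 𝕜 E => F) 2 where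
  toFun T := ⟨fun i => toCLM T (hsBasis 𝕜 E i),
    (isHilbertSchmidt_iff_memlp _).1 (isHilbertSchmidt_toCLM T)⟩
  map_add' S T := by ext i; simp; rfl
  map_smul' c T := by ext i; simp

@[simp] theorem toL2Seq_apply (T : HilbertSchmidt 𝕜 E F) (i : HSIndex 𝕜 E) :
    toL2Seq T i = toCLM T (hsBasis 𝕜 E i) := rfl

theorem toL2Seq_injective :
    Function.Injective (toL2Seq : HilbertSchmidt 𝕜 E F →ₗ[𝕜] _) := by
  intro S T h
  apply toCLM_injective
  have hd : Dense (Submodule.span 𝕜 (Set.range (hsBasis 𝕜 E)) : Set E) := by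
    rw [Submodule.dense_iff_topologicalClosure_eq_top]
    exact (hsBasis 𝕜 E).dense_span
  refine ContinuousLinearMap.ext_on hd ?_
  rintro _ ⟨i, rfl⟩
  rw [← toL2Seq_apply, ← toL2Seq_apply, h]

/-- The Hilbert–Schmidt norm `‖T‖ = (∑ i, ‖T eᵢ‖²)^(1/2)`. -/
instance : NormedAddCommGroup (HilbertSchmidt 𝕜 E F) :=
  NormedAddCommGroup.induced (HilbertSchmidt 𝕜 E F) (lp (fun _ : HSIndex 𝕜 E => F) 2) toL2Seq
    toL2Seq_injective

theorem norm_def (T : HilbertSchmidt 𝕜 E F) : ‖T‖ = ‖toL2Seq T‖ := rfl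

/-- The Hilbert–Schmidt inner product `⟪S, T⟫ = ∑ i, ⟪S eᵢ, T eᵢ⟫`. -/
instance : InnerProductSpace 𝕜 (HilbertSchmidt 𝕜 E F) where
  norm_smul_le c T := by rw [norm_def, map_smul, norm_def, norm_smul]
  inner S T := inner 𝕜 (toL2Seq S) (toL2Seq T)
  norm_sq_eq_re_inner T := by rw [norm_def]; exact norm_sq_eq_re_inner (𝕜 := 𝕜) (toL2Seq T)
  conj_inner_symm S T := inner_conj_symm (𝕜 := 𝕜) (toL2Seq S) (toL2Seq T)
  add_left S S' T := by rw [map_add, inner_add_left]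
  smul_left S T c := by rw [map_smul, inner_smul_left]

end HilbertSchmidt

end HilbertSchmidt

section Independence

variable {𝕜 E F : Type*} [RCLike 𝕜] [NormedAddCommGroup E] [InnerProductSpace 𝕜 E]
  [NormedAddCommGroup F] [InnerProductSpace 𝕜 F]

theorem HilbertBasis.tsum_enorm_inner_sq {ι : Type*} (b : HilbertBasis ι 𝕜 E) (x : E) :
    ∑' i, ‖inner 𝕜 (b i) x‖ₑ ^ 2 = ‖x‖ₑ ^ 2 := by
  have h := lp.hasSum_norm (p := 2) (by simp) (b.repr x)
  simp only [ENNReal.toReal_ofNat, Real.rpow_ofNat, LinearIsometryEquiv.norm_map,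
    b.repr_apply_apply] at h
  have h2 := ENNReal.ofReal_tsum_of_nonneg (fun i => sq_nonneg ‖inner 𝕜 (b i) x‖) h.summable
  rw [h.tsum_eq] at h2
  simpa only [ENNReal.ofReal_pow (norm_nonneg _), ofReal_norm] using h2.symm

theorem summable_norm_sq_iff {ι : Type*} (b : HilbertBasis ι 𝕜 E) (T : E →L[𝕜] F) :
    Summable (fun i => ‖T (b i)‖ ^ 2) ↔ ∑' i, ‖T (b i)‖ₑ ^ 2 ≠ ⊤ := by
  have h : ∀ i, ‖T (b i)‖ₑ ^ 2 = ((‖T (b i)‖₊ ^ 2 : NNReal) : ENNReal) := by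
    intro i; rw [ENNReal.coe_pow]; rfl
  simp_rw [h]
  rw [ENNReal.tsum_coe_ne_top_iff_summable, ← NNReal.summable_coe]
  simp

variable [CompleteSpace E] [CompleteSpace F]

theorem tsum_enorm_sq_eq_adjoint {ι κ : Type*} (b : HilbertBasis ι 𝕜 E) (c : HilbertBasis κ 𝕜 F)
    (T : E →L[𝕜] F) :
    ∑' i, ‖T (b i)‖ₑ ^ 2 = ∑' k, ‖ContinuousLinearMap.adjoint T (c k)‖ₑ ^ 2 := by
  have h1 : ∀ i, ‖T (b i)‖ₑ ^ 2 = ∑' k, ‖inner 𝕜 (c k) (T (b i))‖ₑ ^ 2 :=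
    fun i => (c.tsum_enorm_inner_sq _).symm
  have h2 : ∀ k, ‖ContinuousLinearMap.adjoint T (c k)‖ₑ ^ 2 =
      ∑' i, ‖inner 𝕜 (b i) (ContinuousLinearMap.adjoint T (c k))‖ₑ ^ 2 :=
    fun k => (b.tsum_enorm_inner_sq _).symm
  simp_rw [h1, h2]
  rw [ENNReal.tsum_comm]
  refine tsum_congr fun k => tsum_congr fun i => ?_
  rw [ContinuousLinearMap.adjoint_inner_right, ← inner_conj_symm, ← ofReal_norm,
    RCLike.norm_conj, ofReal_norm]

theorem tsum_enorm_sq_eq {ι κ : Type*} (b : HilbertBasis ι 𝕜 E) (b' : HilbertBasis κ 𝕜 E)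
    (T : E →L[𝕜] F) : ∑' i, ‖T (b i)‖ₑ ^ 2 = ∑' j, ‖T (b' j)‖ₑ ^ 2 := by
  rw [tsum_enorm_sq_eq_adjoint b (hsBasis 𝕜 F), tsum_enorm_sq_eq_adjoint b' (hsBasis 𝕜 F)]

/-- Being Hilbert–Schmidt can be tested on any Hilbert basis. -/
theorem isHilbertSchmidt_iff {ι : Type*} (b : HilbertBasis ι 𝕜 E) (T : E →L[𝕜] F) :
    IsHilbertSchmidt T ↔ Summable fun i => ‖T (b i)‖ ^ 2 := by
  rw [summable_norm_sq_iff, tsum_enorm_sq_eq b (hsBasis 𝕜 E), ← summable_norm_sq_iff]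
  rfl

/-- The Hilbert–Schmidt norm can be computed with any Hilbert basis. -/
theorem HilbertSchmidt.hasSum_norm_sq {ι : Type*} (b : HilbertBasis ι 𝕜 E)
    (T : HilbertSchmidt 𝕜 E F) : HasSum (fun i => ‖toCLM T (b i)‖ ^ 2) (‖T‖ ^ 2) := by
  have h0 : HasSum (fun i => ‖toCLM T (hsBasis 𝕜 E i)‖ ^ 2) (‖T‖ ^ 2) := by
    simpa [← norm_def] using lp.hasSum_norm (p := 2) (by simp) (toL2Seq T)
  have hs : Summable (fun i => ‖toCLM T (b i)‖ ^ 2) :=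
    (isHilbertSchmidt_iff b _).1 (isHilbertSchmidt_toCLM T)
  have e1 := ENNReal.ofReal_tsum_of_nonneg (fun i => sq_nonneg ‖toCLM T (b i)‖) hs
  have e0 := ENNReal.ofReal_tsum_of_nonneg (fun i => sq_nonneg ‖toCLM T (hsBasis 𝕜 E i)‖)
    h0.summable
  simp only [ENNReal.ofReal_pow (norm_nonneg _), ofReal_norm] at e0 e1
  rw [tsum_enorm_sq_eq b (hsBasis 𝕜 E), ← e0, ENNReal.ofReal_eq_ofReal_iff
    (tsum_nonneg fun _ => sq_nonneg _) (tsum_nonneg fun _ => sq_nonneg _), h0.tsum_eq] at e1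
  rw [← e1]
  exact hs.hasSum

end Independence

section KernelOperator

variable {𝕜 Ω₁ Ω₂ E F : Type*} [RCLike 𝕜] [MeasurableSpace Ω₁] [MeasurableSpace Ω₂]
  {μ₁ : Measure Ω₁} {μ₂ : Measure Ω₂}
  [NormedAddCommGroup E] [InnerProductSpace 𝕜 E] [CompleteSpace E]
  [NormedAddCommGroup F] [InnerProductSpace 𝕜 F]

/-- `T` is the integral operator with kernel `k`: for every `f ∈ L²(Ω₁; E)` and `v ∈ F`,
`⟪v, (T f)(ω₂)⟫ = ∫ ⟪v, k(ω₁, ω₂) f(ω₁)⟫ dμ₁(ω₁)` for almost every `ω₂`, where the integrand is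
integrable. -/
def IsKernelOperator (k : Lp (HilbertSchmidt 𝕜 E F) 2 (μ₁.prod μ₂))
    (T : Lp E 2 μ₁ →L[𝕜] Lp F 2 μ₂) : Prop :=
  ∀ (f : Lp E 2 μ₁) (v : F), ∀ᵐ ω₂ ∂μ₂,
    Integrable (fun ω₁ => inner 𝕜 v (HilbertSchmidt.toCLM (k (ω₁, ω₂)) (f ω₁))) μ₁ ∧
    inner 𝕜 v (T f ω₂) = ∫ ω₁, inner 𝕜 v (HilbertSchmidt.toCLM (k (ω₁, ω₂)) (f ω₁)) ∂μ₁

end KernelOperator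

end

noncomputable section

/-! ### Rank one operators; completeness of the Hilbert–Schmidt space -/

section RankOne

variable {𝕜 E F : Type*} [RCLike 𝕜] [NormedAddCommGroup E] [InnerProductSpace 𝕜 E]
  [CompleteSpace E] [NormedAddCommGroup F] [InnerProductSpace 𝕜 F]

open InnerProductSpace

/-! Both sides are models of one Hilbert space: the tensor product of `L²(Ω₂; F)` with the conjugate
of `L²(Ω₁; E)`. The elementary tensor of `g` and `f` is the rank one operator `⟪f, ·⟫ g` in one
model and the kernel `⟪f(ω₁), ·⟫ g(ω₂)` in the other. In both, inner products of elementary tensors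
are `⟪g, g'⟫ ⟪f', f⟫` and elementary tensors are total (`isHilbertTensor_rankOneL`,
`isHilbertTensor_rankOneKernelL`), so a unitary `Φ` matches them (`exists_linearIsometryEquiv`).

Pairing with elementary tensors gives `⟪g, Φ(k) f⟫ = ∫∫ ⟪g(ω₂), k(ω₁, ω₂) f(ω₁)⟫`. Taking `g = 1_t
v` and applying Fubini yields the pointwise formula for almost every `ω₂`
(`isKernelOperator_of_inner_eq`). All tests use one vector at a time, so separability plays no role.
-/

theorem isHilbertSchmidt_rankOne (v : F) (e : E) : IsHilbertSchmidt (rankOne 𝕜 v e) := by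
  rw [isHilbertSchmidt_iff_memlp, memℓp_gen_iff (by simp)]
  have h := (lp.hasSum_norm (p := 2) (by simp) ((hsBasis 𝕜 E).repr e)).summable.mul_right (‖v‖ ^ 2)
  simp only [(hsBasis 𝕜 E).repr_apply_apply, ENNReal.toReal_ofNat, Real.rpow_ofNat] at h ⊢
  refine h.congr fun i => ?_
  rw [rankOne_apply, norm_smul, mul_pow, norm_inner_symm]

namespace HilbertSchmidt

theorem inner_def (S T : HilbertSchmidt 𝕜 E F) : inner 𝕜 S T = inner 𝕜 (toL2Seq S) (toL2Seq T) :=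
  rfl

/-- The rank one operator `x ↦ ⟪e, x⟫ v` as a Hilbert–Schmidt operator. -/
def mkRankOne (v : F) (e : E) : HilbertSchmidt 𝕜 E F := ⟨rankOne 𝕜 v e, isHilbertSchmidt_rankOne v e⟩

@[simp] theorem toCLM_mkRankOne (v : F) (e : E) :
    toCLM (mkRankOne v e : HilbertSchmidt 𝕜 E F) = rankOne 𝕜 v e := rfl

/-- Expand `e` in the basis and apply `⟪v, T ·⟫` termwise. Matrix coefficients thereby become
Hilbert–Schmidt inner products. -/
theorem inner_mkRankOne_left (v : F) (e : E) (T : HilbertSchmidt 𝕜 E F) :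
    inner 𝕜 (mkRankOne v e) T = inner 𝕜 v (toCLM T e) := by
  have h := (((hsBasis 𝕜 E).hasSum_repr e).mapL (toCLM T)).mapL (innerSL 𝕜 v)
  rw [inner_def]
  refine (lp.hasSum_inner _ _).unique ?_
  simpa [inner_smul_left, (hsBasis 𝕜 E).repr_apply_apply] using h

theorem norm_mkRankOne (v : F) (e : E) :
    ‖(mkRankOne v e : HilbertSchmidt 𝕜 E F)‖ = ‖v‖ * ‖e‖ := by
  rw [← sq_eq_sq₀ (norm_nonneg _) (by positivity), mul_pow]
  have h := inner_mkRankOne_left v e (mkRankOne v e : HilbertSchmidt 𝕜 E F)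
  rw [toCLM_mkRankOne, rankOne_apply, inner_smul_right, inner_self_eq_norm_sq_to_K,
    inner_self_eq_norm_sq_to_K, inner_self_eq_norm_sq_to_K, mul_comm] at h
  exact_mod_cast h

variable (𝕜 E F) in
/-- The continuous sesquilinear map sending `(v, e)` to the rank one operator `x ↦ ⟪e, x⟫ v`. -/
def rankOneL : F →L[𝕜] E →L⋆[𝕜] HilbertSchmidt 𝕜 E F :=
  LinearMap.mkContinuous₂
    (LinearMap.mk₂'ₛₗ (RingHom.id 𝕜) (starRingEnd 𝕜) mkRankOne
      (fun v w e => toCLM_injective (by simp))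
      (fun c v e => toCLM_injective (by simp))
      (fun v e e' => toCLM_injective (by simp))
      (fun c v e => toCLM_injective (by simp)))
    1 fun v e => by simp [norm_mkRankOne]

@[simp] theorem rankOneL_apply (v : F) (e : E) : rankOneL 𝕜 E F v e = mkRankOne v e := rfl

/-- Joint continuity gives strong measurability of rank one kernels by composition. -/
theorem continuous_mkRankOne :
    Continuous fun p : F × E => (mkRankOne p.1 p.2 : HilbertSchmidt 𝕜 E F) := by
  refine continuous_iff_continuousAt.2 fun q => tendsto_iff_norm_sub_tendsto_zero.2 ?_
  have hb : ∀ p : F × E, ‖(mkRankOne p.1 p.2 - mkRankOne q.1 q.2 : HilbertSchmidt 𝕜 E F)‖ ≤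
      ‖p.1 - q.1‖ * ‖p.2‖ + ‖q.1‖ * ‖p.2 - q.2‖ := fun p => by
    rw [← norm_mkRankOne (𝕜 := 𝕜), ← norm_mkRankOne (𝕜 := 𝕜)]
    refine le_trans (le_of_eq ?_) (norm_add_le _ _)
    simp only [← rankOneL_apply, map_sub, sub_apply]
    congr 1
    abel
  refine squeeze_zero (fun _ => norm_nonneg _) hb ?_
  have hc : Continuous fun p : F × E => ‖p.1 - q.1‖ * ‖p.2‖ + ‖q.1‖ * ‖p.2 - q.2‖ := by fun_prop
  simpa using hc.tendsto q

theorem toL2Seq_surjective [CompleteSpace F] :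
    Function.Surjective (toL2Seq : HilbertSchmidt 𝕜 E F →ₗ[𝕜] _) := by
  intro a
  let B : HSIndex 𝕜 E → 𝕜 →L[𝕜] F →L[𝕜] F := fun _ => ContinuousLinearMap.lsmul 𝕜 𝕜
  have hB : ∀ i, ‖B i‖ ≤ (1 : NNReal) := fun _ => ContinuousLinearMap.opNorm_lsmul_le
  -- `T x = ∑ ⟪eᵢ, x⟫ aᵢ`, bounded by Hölder with exponents 2 and 2.
  let T : E →L[𝕜] F :=
    (lp.dualPairing 2 2 B hB).flip a ∘L ((hsBasis 𝕜 E).repr : E →L[𝕜] _)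
  have hT : ∀ i, T (hsBasis 𝕜 E i) = a i := by
    intro i
    have : T (hsBasis 𝕜 E i) = ∑' j, (hsBasis 𝕜 E).repr (hsBasis 𝕜 E i) j • a j := rfl
    classical
    rw [this, tsum_eq_single i]
    · rw [(hsBasis 𝕜 E).repr_self, lp.single_apply_self, one_smul]
    · intro j hj
      rw [(hsBasis 𝕜 E).repr_self, lp.single_apply_ne _ _ _ hj, zero_smul]
  refine ⟨⟨T, (isHilbertSchmidt_iff_memlp T).2 ?_⟩, ?_⟩
  · simp_rw [hT]; exact a.2
  · ext i; exact hT i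

instance [CompleteSpace F] : CompleteSpace (HilbertSchmidt 𝕜 E F) := by
  have h : Isometry (toL2Seq : HilbertSchmidt 𝕜 E F →ₗ[𝕜] _) :=
    AddMonoidHomClass.isometry_of_norm _ fun T => (norm_def T).symm
  rw [completeSpace_iff_isComplete_univ, ← h.isUniformInducing.isComplete_iff, Set.image_univ,
    toL2Seq_surjective.range_eq, ← completeSpace_iff_isComplete_univ]
  infer_instance

end HilbertSchmidt

end RankOne

/-! ### Hilbert space tensor products and their uniqueness -/

section HilbertTensor

variable {𝕜 G H X Y : Type*} [RCLike 𝕜]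
  [NormedAddCommGroup G] [InnerProductSpace 𝕜 G]
  [NormedAddCommGroup H] [InnerProductSpace 𝕜 H]
  [NormedAddCommGroup X] [InnerProductSpace 𝕜 X]
  [NormedAddCommGroup Y] [InnerProductSpace 𝕜 Y]

/-- Continuous sesquilinear maps that agree on Hilbert bases are equal. -/
theorem HilbertBasis.ext_sesquilinear {ι κ : Type*} (b : HilbertBasis ι 𝕜 G)
    (c : HilbertBasis κ 𝕜 H) {B B' : G →L[𝕜] H →L⋆[𝕜] X}
    (h : ∀ i j, B (b i) (c j) = B' (b i) (c j)) : B = B' := by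
  have hb := Submodule.dense_iff_topologicalClosure_eq_top.2 b.dense_span
  have hc := Submodule.dense_iff_topologicalClosure_eq_top.2 c.dense_span
  refine ContinuousLinearMap.ext_on hb ?_
  rintro _ ⟨i, rfl⟩
  refine ContinuousLinearMap.ext_on hc ?_
  rintro _ ⟨j, rfl⟩
  exact h i j

/-- A sesquilinear map `B` exhibiting `X` as the Hilbert space tensor product of `G` and the
conjugate of `H`: inner products of elementary tensors factor, and these tensors are total. -/
structure IsHilbertTensor (B : G →L[𝕜] H →L⋆[𝕜] X) : Prop where
  inner_eq : ∀ g h g' h', inner 𝕜 (B g h) (B g' h') = inner 𝕜 g g' * inner 𝕜 h' h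
  eq_zero : ∀ x, (∀ g h, inner 𝕜 (B g h) x = 0) → x = 0

namespace IsHilbertTensor

variable {B : G →L[𝕜] H →L⋆[𝕜] X}

theorem orthonormal (hB : IsHilbertTensor B) {ι κ : Type*} {b : ι → G} {c : κ → H}
    (hb : Orthonormal 𝕜 b) (hc : Orthonormal 𝕜 c) :
    Orthonormal 𝕜 fun p : ι × κ => B (b p.1) (c p.2) := by
  classical
  rw [orthonormal_iff_ite] at *
  rintro ⟨i, j⟩ ⟨i', j'⟩
  rw [hB.inner_eq, hb, hc]
  simp only [Prod.mk.injEq]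
  split_ifs <;> simp_all

/-- The elementary tensors of basis vectors form a Hilbert basis. -/
def hilbertBasis [CompleteSpace X] (hB : IsHilbertTensor B) {ι κ : Type*} (b : HilbertBasis ι 𝕜 G)
    (c : HilbertBasis κ 𝕜 H) : HilbertBasis (ι × κ) 𝕜 X :=
  HilbertBasis.mkOfOrthogonalEqBot (hB.orthonormal b.orthonormal c.orthonormal) <| by
    rw [Submodule.eq_bot_iff]
    intro x hx
    refine hB.eq_zero x fun g h => ?_
    rw [← inner_conj_symm, map_eq_zero]
    -- With `x` in the first slot, `(g, h) ↦ ⟪x, B g h⟫` keeps the sesquilinearity of `B`, so its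
    -- vanishing on basis pairs suffices.
    have : (innerSL 𝕜 x).postcomp H ∘L B = 0 := by
      refine b.ext_sesquilinear c fun i j => ?_
      rw [Submodule.mem_orthogonal'] at hx
      exact hx _ (Submodule.subset_span ⟨(i, j), rfl⟩)
    exact congr($this g h)

theorem hilbertBasis_apply [CompleteSpace X] (hB : IsHilbertTensor B) {ι κ : Type*}
    (b : HilbertBasis ι 𝕜 G) (c : HilbertBasis κ 𝕜 H) (p : ι × κ) :
    hB.hilbertBasis b c p = B (b p.1) (c p.2) := by
  simp [hilbertBasis]

variable [CompleteSpace G] [CompleteSpace H]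

/-- The Hilbert space tensor product is unique up to an isometric isomorphism. -/
theorem exists_linearIsometryEquiv [CompleteSpace X] [CompleteSpace Y] (hB : IsHilbertTensor B)
    {C : G →L[𝕜] H →L⋆[𝕜] Y} (hC : IsHilbertTensor C) :
    ∃ Φ : X ≃ₗᵢ[𝕜] Y, ∀ g h, Φ (B g h) = C g h := by
  let b := hsBasis 𝕜 G
  let c := hsBasis 𝕜 H
  let Φ := (hB.hilbertBasis b c).repr.trans (hC.hilbertBasis b c).repr.symm
  refine ⟨Φ, fun g h => ?_⟩
  have : (Φ : X →L[𝕜] Y).postcomp H ∘L B = C := by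
    refine b.ext_sesquilinear c fun i j => ?_
    have h1 : Φ (hB.hilbertBasis b c (i, j)) = hC.hilbertBasis b c (i, j) := by
      classical
      rw [LinearIsometryEquiv.trans_apply, HilbertBasis.repr_self, HilbertBasis.repr_symm_single]
    rwa [hilbertBasis_apply, hilbertBasis_apply] at h1
  exact congr($this g h)

end IsHilbertTensor

/-- Totality: testing `T` against the tensor of `T h` and `h` gives `‖T h‖² = 0`. -/
theorem HilbertSchmidt.isHilbertTensor_rankOneL [CompleteSpace H] : IsHilbertTensor (rankOneL 𝕜 H G) where
  inner_eq g h g' h' := by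
    rw [rankOneL_apply, rankOneL_apply, inner_mkRankOne_left, toCLM_mkRankOne,
      InnerProductSpace.rankOne_apply, inner_smul_right, mul_comm]
  eq_zero T hT := by
    refine toCLM_injective (ContinuousLinearMap.ext fun h => ?_)
    rw [map_zero, zero_apply, ← inner_self_eq_zero (𝕜 := 𝕜)]
    simpa only [rankOneL_apply, inner_mkRankOne_left] using hT (toCLM T h) h

end HilbertTensor

/-! ### Kernels and their integral operators -/

section Kernel

open HilbertSchmidt

variable {𝕜 Ω₁ Ω₂ E F : Type*} [RCLike 𝕜] [MeasurableSpace Ω₁] [MeasurableSpace Ω₂]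
  {μ₁ : Measure Ω₁} {μ₂ : Measure Ω₂}

/-- An `L²` function on a product all of whose integrals over finite rectangles vanish is zero. -/
theorem MeasureTheory.Lp.eq_zero_of_forall_setIntegral_prod_eq_zero [SigmaFinite μ₁]
    [SigmaFinite μ₂] {X : Type*} [NormedAddCommGroup X] [NormedSpace ℝ X] [CompleteSpace X] (f : Lp X 2 (μ₁.prod μ₂))
    (hf : ∀ s t, MeasurableSet s → MeasurableSet t → μ₁ s ≠ ⊤ → μ₂ t ≠ ⊤ →
      ∫ ω in s ×ˢ t, f ω ∂(μ₁.prod μ₂) = 0) : f = 0 := by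
  -- On each finite rectangle `A n` the function is integrable and its total integral vanishes, as
  -- the complement step of the π-λ argument requires.
  let A : ℕ → Set (Ω₁ × Ω₂) := fun n => spanningSets μ₁ n ×ˢ spanningSets μ₂ n
  have hAm : ∀ n, MeasurableSet (A n) := fun n =>
    (measurableSet_spanningSets μ₁ n).prod (measurableSet_spanningSets μ₂ n)
  have hAf : ∀ n, (μ₁.prod μ₂) (A n) ≠ ⊤ := fun n => by
    rw [Measure.prod_prod]
    exact (ENNReal.mul_lt_top (measure_spanningSets_lt_top μ₁ n)
      (measure_spanningSets_lt_top μ₂ n)).ne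
  have hint : ∀ n, IntegrableOn f (A n) (μ₁.prod μ₂) := fun n =>
    integrableOn_Lp_of_measure_ne_top f one_le_two (hAf n)
  have hrect : ∀ n s t, MeasurableSet s → MeasurableSet t →
      ∫ ω in s ×ˢ t, f ω ∂(μ₁.prod μ₂).restrict (A n) = 0 := by
    intro n s t hs ht
    rw [Measure.restrict_restrict (hs.prod ht), Set.prod_inter_prod]
    exact hf _ _ (hs.inter (measurableSet_spanningSets _ _))
      (ht.inter (measurableSet_spanningSets _ _))
      (measure_inter_lt_top_of_right_ne_top (measure_spanningSets_lt_top μ₁ n).ne).ne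
      (measure_inter_lt_top_of_right_ne_top (measure_spanningSets_lt_top μ₂ n).ne).ne
  have huniv : ∀ n, ∫ ω, f ω ∂(μ₁.prod μ₂).restrict (A n) = 0 := fun n => by
    simpa using hrect n _ _ MeasurableSet.univ MeasurableSet.univ
  have key : ∀ n s, MeasurableSet s → ∫ ω in s, f ω ∂(μ₁.prod μ₂).restrict (A n) = 0 := by
    intro n s hs
    induction s, hs using MeasurableSpace.induction_on_inter generateFrom_prod.symm
      isPiSystem_prod with
    | empty => simp
    | basic s hs =>
      obtain ⟨s, hs, t, ht, rfl⟩ := hs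
      exact hrect n s t hs ht
    | compl s hs ih =>
      rw [setIntegral_compl hs (hint n), ih, huniv, sub_zero]
    | iUnion g hd hm ih =>
      rw [integral_iUnion hm hd (hint n).integrableOn]
      simp [ih]
  have hz : ∀ n, ∀ᵐ ω ∂(μ₁.prod μ₂), ω ∈ A n → f ω = 0 := fun n => by
    rw [← ae_restrict_iff' (hAm n)]
    exact (hint n).ae_eq_zero_of_forall_setIntegral_eq_zero fun s hs _ => key n s hs
  rw [Lp.eq_zero_iff_ae_eq_zero]
  filter_upwards [ae_all_iff.2 hz] with ω hω
  refine hω (max (spanningSetsIndex μ₁ ω.1) (spanningSetsIndex μ₂ ω.2)) ⟨?_, ?_⟩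
  · exact monotone_spanningSets μ₁ (le_max_left _ _) (mem_spanningSetsIndex μ₁ _)
  · exact monotone_spanningSets μ₂ (le_max_right _ _) (mem_spanningSetsIndex μ₂ _)

variable [NormedAddCommGroup E] [InnerProductSpace 𝕜 E] [CompleteSpace E]
  [NormedAddCommGroup F] [InnerProductSpace 𝕜 F]

theorem aestronglyMeasurable_mkRankOne {Ω : Type*} [MeasurableSpace Ω] {μ : Measure Ω}
    {g : Ω → F} {f : Ω → E} (h : AEStronglyMeasurable (fun ω => (g ω, f ω)) μ) :
    AEStronglyMeasurable (fun ω => (mkRankOne (g ω) (f ω) : HilbertSchmidt 𝕜 E F)) μ := by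
  have := Continuous.comp_aestronglyMeasurable
    (g := fun p : F × E => (mkRankOne p.1 p.2 : HilbertSchmidt 𝕜 E F)) continuous_mkRankOne h
  exact this

theorem memLp_mkRankOne (g : Lp F 2 μ₂) (f : Lp E 2 μ₁) :
    MemLp (fun ω : Ω₁ × Ω₂ => (mkRankOne (g ω.2) (f ω.1) : HilbertSchmidt 𝕜 E F)) 2
      (μ₁.prod μ₂) := by
  have hg : AEStronglyMeasurable (fun ω : Ω₁ × Ω₂ => g ω.2) (μ₁.prod μ₂) :=
    (Lp.aestronglyMeasurable g).comp_snd
  have hf : AEStronglyMeasurable (fun ω : Ω₁ × Ω₂ => f ω.1) (μ₁.prod μ₂) :=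
    (Lp.aestronglyMeasurable f).comp_fst
  have hm : AEStronglyMeasurable
      (fun ω : Ω₁ × Ω₂ => (mkRankOne (g ω.2) (f ω.1) : HilbertSchmidt 𝕜 E F)) (μ₁.prod μ₂) :=
    aestronglyMeasurable_mkRankOne (hg.prodMk hf)
  have hf2 : Integrable (fun ω₁ => ‖f ω₁‖ ^ 2) μ₁ := (Lp.memLp f).integrable_norm_pow two_ne_zero
  have hg2 : Integrable (fun ω₂ => ‖g ω₂‖ ^ 2) μ₂ := (Lp.memLp g).integrable_norm_pow two_ne_zero
  refine (memLp_two_iff_integrable_sq_norm hm).2 ((hf2.mul_prod hg2).congr (.of_forall fun ω => ?_))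
  simp only [norm_mkRankOne, mul_pow, mul_comm]

/-- The rank one kernel `(ω₁, ω₂) ↦ (x ↦ ⟪f(ω₁), x⟫ g(ω₂))`. -/
def rankOneKernel (g : Lp F 2 μ₂) (f : Lp E 2 μ₁) : Lp (HilbertSchmidt 𝕜 E F) 2 (μ₁.prod μ₂) :=
  (memLp_mkRankOne g f).toLp

theorem coeFn_rankOneKernel (g : Lp F 2 μ₂) (f : Lp E 2 μ₁) :
    (rankOneKernel g f : Lp (HilbertSchmidt 𝕜 E F) 2 (μ₁.prod μ₂)) =ᵐ[μ₁.prod μ₂]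
      fun ω => mkRankOne (g ω.2) (f ω.1) :=
  (memLp_mkRankOne g f).coeFn_toLp

/-- The integrand is the pointwise inner product of two `L²` functions, a rank one kernel and `k`.
-/
theorem integrable_inner_kernel (k : Lp (HilbertSchmidt 𝕜 E F) 2 (μ₁.prod μ₂)) (g : Lp F 2 μ₂)
    (f : Lp E 2 μ₁) :
    Integrable (fun ω => inner 𝕜 (g ω.2) (toCLM (k ω) (f ω.1))) (μ₁.prod μ₂) := by
  refine (L2.integrable_inner (𝕜 := 𝕜) (rankOneKernel g f) k).congr ?_
  filter_upwards [coeFn_rankOneKernel (𝕜 := 𝕜) g f] with ω hω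
  rw [hω, inner_mkRankOne_left]

theorem inner_rankOneKernel_left (k : Lp (HilbertSchmidt 𝕜 E F) 2 (μ₁.prod μ₂)) (g : Lp F 2 μ₂)
    (f : Lp E 2 μ₁) :
    inner 𝕜 (rankOneKernel g f) k =
      ∫ ω, inner 𝕜 (g ω.2) (toCLM (k ω) (f ω.1)) ∂(μ₁.prod μ₂) := by
  rw [L2.inner_def]
  refine integral_congr_ae ?_
  filter_upwards [coeFn_rankOneKernel (𝕜 := 𝕜) g f] with ω hω
  rw [hω, inner_mkRankOne_left]

variable [SigmaFinite μ₁] [SigmaFinite μ₂]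

/-- The integrand factors into a function of `ω₁` times a function of `ω₂`. -/
theorem inner_rankOneKernel_rankOneKernel (g g' : Lp F 2 μ₂) (f f' : Lp E 2 μ₁) :
    inner 𝕜 (rankOneKernel g f : Lp (HilbertSchmidt 𝕜 E F) 2 (μ₁.prod μ₂)) (rankOneKernel g' f') =
      inner 𝕜 g g' * inner 𝕜 f' f := by
  rw [inner_rankOneKernel_left, mul_comm, L2.inner_def, L2.inner_def, ← integral_prod_mul]
  refine integral_congr_ae ?_
  filter_upwards [coeFn_rankOneKernel (𝕜 := 𝕜) g' f'] with ω hω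
  rw [hω, toCLM_mkRankOne, InnerProductSpace.rankOne_apply, inner_smul_right]

theorem norm_rankOneKernel (g : Lp F 2 μ₂) (f : Lp E 2 μ₁) :
    ‖(rankOneKernel g f : Lp (HilbertSchmidt 𝕜 E F) 2 (μ₁.prod μ₂))‖ = ‖g‖ * ‖f‖ := by
  rw [← sq_eq_sq₀ (norm_nonneg _) (by positivity), mul_pow]
  have h := inner_rankOneKernel_rankOneKernel (𝕜 := 𝕜) g g f f
  rw [inner_self_eq_norm_sq_to_K, inner_self_eq_norm_sq_to_K, inner_self_eq_norm_sq_to_K] at h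
  exact_mod_cast h

variable (𝕜 E F μ₁ μ₂) in
/-- `rankOneKernel` as a continuous sesquilinear map. -/
def rankOneKernelL :
    Lp F 2 μ₂ →L[𝕜] Lp E 2 μ₁ →L⋆[𝕜] Lp (HilbertSchmidt 𝕜 E F) 2 (μ₁.prod μ₂) :=
  LinearMap.mkContinuous₂
    (LinearMap.mk₂'ₛₗ (RingHom.id 𝕜) (starRingEnd 𝕜) rankOneKernel
      (fun g g' f => by
        refine Lp.ext ?_
        filter_upwards [coeFn_rankOneKernel (𝕜 := 𝕜) (g + g') f,
          coeFn_rankOneKernel (𝕜 := 𝕜) g f, coeFn_rankOneKernel (𝕜 := 𝕜) g' f,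
          Lp.coeFn_add (rankOneKernel (𝕜 := 𝕜) g f) (rankOneKernel g' f),
          Measure.quasiMeasurePreserving_snd.ae (Lp.coeFn_add g g')] with ω h1 h2 h3 h4 h5
        rw [h1, h4, Pi.add_apply, h2, h3, h5, Pi.add_apply]
        simp only [← rankOneL_apply, map_add, add_apply])
      (fun c g f => by
        refine Lp.ext ?_
        filter_upwards [coeFn_rankOneKernel (𝕜 := 𝕜) (c • g) f,
          coeFn_rankOneKernel (𝕜 := 𝕜) g f,
          Lp.coeFn_smul c (rankOneKernel (𝕜 := 𝕜) g f),
          Measure.quasiMeasurePreserving_snd.ae (Lp.coeFn_smul c g)] with ω h1 h2 h3 h4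
        rw [h1, RingHom.id_apply, h3, Pi.smul_apply, h2, h4, Pi.smul_apply]
        simp only [← rankOneL_apply, map_smul, smul_apply])
      (fun g f f' => by
        refine Lp.ext ?_
        filter_upwards [coeFn_rankOneKernel (𝕜 := 𝕜) g (f + f'),
          coeFn_rankOneKernel (𝕜 := 𝕜) g f, coeFn_rankOneKernel (𝕜 := 𝕜) g f',
          Lp.coeFn_add (rankOneKernel (𝕜 := 𝕜) g f) (rankOneKernel g f'),
          Measure.quasiMeasurePreserving_fst.ae (Lp.coeFn_add f f')] with ω h1 h2 h3 h4 h5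
        rw [h1, h4, Pi.add_apply, h2, h3, h5, Pi.add_apply]
        simp only [← rankOneL_apply, map_add])
      (fun c g f => by
        refine Lp.ext ?_
        filter_upwards [coeFn_rankOneKernel (𝕜 := 𝕜) g (c • f),
          coeFn_rankOneKernel (𝕜 := 𝕜) g f,
          Lp.coeFn_smul (starRingEnd 𝕜 c) (rankOneKernel (𝕜 := 𝕜) g f),
          Measure.quasiMeasurePreserving_fst.ae (Lp.coeFn_smul c f)] with ω h1 h2 h3 h4
        rw [h1, h3, Pi.smul_apply, h2, h4, Pi.smul_apply]
        simp only [← rankOneL_apply, map_smulₛₗ]))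
    1 fun g f => by simp [norm_rankOneKernel]

@[simp] theorem rankOneKernelL_apply (g : Lp F 2 μ₂) (f : Lp E 2 μ₁) :
    rankOneKernelL 𝕜 E F μ₁ μ₂ g f = rankOneKernel g f := rfl

/-- Totality: the tensors of `1_t v` and `1_s e` pair with `k` to `⟪v, (∫_{s × t} k) e⟫`, so all
integrals of `k` over finite rectangles vanish. -/
theorem isHilbertTensor_rankOneKernelL [CompleteSpace F] : IsHilbertTensor (rankOneKernelL 𝕜 E F μ₁ μ₂) where
  inner_eq g f g' f' := inner_rankOneKernel_rankOneKernel g g' f f'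
  eq_zero k hk := by
    let : NormedSpace ℝ (HilbertSchmidt 𝕜 E F) := NormedSpace.restrictScalars ℝ 𝕜 _
    refine Lp.eq_zero_of_forall_setIntegral_prod_eq_zero k fun s t hs ht hμs hμt => ?_
    refine toCLM_injective (ContinuousLinearMap.ext fun e => ?_)
    rw [map_zero, zero_apply]
    refine ext_inner_left 𝕜 fun v => ?_
    have hst : (μ₁.prod μ₂) (s ×ˢ t) ≠ ⊤ := by
      rw [Measure.prod_prod]; exact ENNReal.mul_ne_top hμs hμt
    rw [← inner_mkRankOne_left, ← integral_inner
      (integrableOn_Lp_of_measure_ne_top k one_le_two hst), inner_zero_right,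
      ← hk (indicatorConstLp 2 ht hμt v) (indicatorConstLp 2 hs hμs e), rankOneKernelL_apply,
      inner_rankOneKernel_left, ← integral_indicator (hs.prod ht)]
    refine integral_congr_ae ?_
    filter_upwards [Measure.quasiMeasurePreserving_fst.ae
        (indicatorConstLp_coeFn (p := 2) (hs := hs) (hμs := hμs) (c := e)),
      Measure.quasiMeasurePreserving_snd.ae
        (indicatorConstLp_coeFn (p := 2) (hs := ht) (hμs := hμt) (c := v))] with ω h1 h2
    rw [h1, h2]
    by_cases hω1 : ω.1 ∈ s <;> by_cases hω2 : ω.2 ∈ t <;>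
      simp [Set.indicator, hω1, hω2, inner_mkRankOne_left]

/-- A bounded operator `T` whose matrix coefficients are those of the kernel `k` is the integral
operator with kernel `k`. -/
theorem isKernelOperator_of_inner_eq {k : Lp (HilbertSchmidt 𝕜 E F) 2 (μ₁.prod μ₂)}
    {T : Lp E 2 μ₁ →L[𝕜] Lp F 2 μ₂}
    (h : ∀ g f, inner 𝕜 g (T f) = inner 𝕜 (rankOneKernel g f) k) : IsKernelOperator k T := by
  intro f v
  -- The constant `v` need not lie in `L²(Ω₂; F)`, so it is replaced by `1_t v` with `μ₂ t` finite.
  have hint : ∀ t, MeasurableSet t → μ₂ t ≠ ⊤ →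
      Integrable (fun ω : Ω₁ × Ω₂ => inner 𝕜 v (toCLM (k ω) (f ω.1)))
        (μ₁.prod (μ₂.restrict t)) := by
    intro t ht hμt
    have h2 : μ₁.prod (μ₂.restrict t) = (μ₁.prod μ₂).restrict (Set.univ ×ˢ t) := by
      rw [← Measure.prod_restrict, Measure.restrict_univ]
    have h1 := (integrable_inner_kernel k (indicatorConstLp 2 ht hμt v) f).restrict
      (s := Set.univ ×ˢ t)
    rw [h2]
    refine h1.congr ?_
    rw [Filter.EventuallyEq, ae_restrict_iff' (MeasurableSet.univ.prod ht)]
    filter_upwards [Measure.quasiMeasurePreserving_snd.ae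
        (indicatorConstLp_coeFn (p := 2) (hs := ht) (hμs := hμt) (c := v))] with ω h3 hω
    rw [h3, Set.indicator_of_mem hω.2]
  have hval : ∀ t, MeasurableSet t → μ₂ t < ⊤ → ∫ ω₂ in t, inner 𝕜 v (T f ω₂) ∂μ₂ =
      ∫ ω₂ in t, ∫ ω₁, inner 𝕜 v (toCLM (k (ω₁, ω₂)) (f ω₁)) ∂μ₁ ∂μ₂ := by
    intro t ht hμt
    rw [← L2.inner_indicatorConstLp_eq_setIntegral_inner 𝕜 (T f) ht v hμt.ne, h,
      inner_rankOneKernel_left, ← integral_prod_symm _ (hint t ht hμt.ne)]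
    have h2 : μ₁.prod (μ₂.restrict t) = (μ₁.prod μ₂).restrict (Set.univ ×ˢ t) := by
      rw [← Measure.prod_restrict, Measure.restrict_univ]
    rw [h2, ← integral_indicator (MeasurableSet.univ.prod ht)]
    refine integral_congr_ae ?_
    filter_upwards [Measure.quasiMeasurePreserving_snd.ae
        (indicatorConstLp_coeFn (p := 2) (hs := ht) (hμs := hμt.ne) (c := v))] with ω h3
    rw [h3]
    by_cases hω : ω.2 ∈ t <;> simp [Set.indicator, hω]
  have h1 : ∀ᵐ ω₂ ∂μ₂, Integrable (fun ω₁ => inner 𝕜 v (toCLM (k (ω₁, ω₂)) (f ω₁))) μ₁ := by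
    have : ∀ n, ∀ᵐ ω₂ ∂μ₂, ω₂ ∈ spanningSets μ₂ n →
        Integrable (fun ω₁ => inner 𝕜 v (toCLM (k (ω₁, ω₂)) (f ω₁))) μ₁ := fun n => by
      rw [← ae_restrict_iff' (measurableSet_spanningSets μ₂ n)]
      exact (hint _ (measurableSet_spanningSets μ₂ n)
        (measure_spanningSets_lt_top μ₂ n).ne).prod_left_ae
    filter_upwards [ae_all_iff.2 this] with ω₂ hω₂
    exact hω₂ _ (mem_spanningSetsIndex μ₂ ω₂)
  have h2 : (fun ω₂ => inner 𝕜 v (T f ω₂)) =ᵐ[μ₂]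
      fun ω₂ => ∫ ω₁, inner 𝕜 v (toCLM (k (ω₁, ω₂)) (f ω₁)) ∂μ₁ := by
    refine ae_eq_of_forall_setIntegral_eq_of_sigmaFinite ?_ ?_ hval
    · intro t _ hμt
      exact (integrableOn_Lp_of_measure_ne_top (T f) one_le_two hμt.ne).const_inner v
    · intro t ht hμt
      exact (hint t ht hμt.ne).integral_prod_right
  exact h1.and h2

end Kernel

/-- A kernel determines its integral operator. -/
theorem IsKernelOperator.unique {𝕜 Ω₁ Ω₂ E F : Type*} [RCLike 𝕜] [MeasurableSpace Ω₁]
    [MeasurableSpace Ω₂] {μ₁ : Measure Ω₁} {μ₂ : Measure Ω₂} [SigmaFinite μ₂]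
    [NormedAddCommGroup E] [InnerProductSpace 𝕜 E] [CompleteSpace E]
    [NormedAddCommGroup F] [InnerProductSpace 𝕜 F] [CompleteSpace F]
    {k : Lp (HilbertSchmidt 𝕜 E F) 2 (μ₁.prod μ₂)}
    {S T : Lp E 2 μ₁ →L[𝕜] Lp F 2 μ₂} (hS : IsKernelOperator k S) (hT : IsKernelOperator k T) :
    S = T := by
  let : NormedSpace ℝ F := NormedSpace.restrictScalars ℝ 𝕜 F
  refine ContinuousLinearMap.ext fun f => Lp.ext ?_
  refine ae_eq_of_forall_setIntegral_eq_of_sigmaFinite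
    (fun t _ hμt => integrableOn_Lp_of_measure_ne_top _ one_le_two hμt.ne)
    (fun t _ hμt => integrableOn_Lp_of_measure_ne_top _ one_le_two hμt.ne) fun t ht hμt => ?_
  -- The exceptional null set depends on `v`, so vectors `∫_t` are compared instead of pointwise
  -- values.
  refine ext_inner_left 𝕜 fun v => ?_
  rw [← integral_inner (integrableOn_Lp_of_measure_ne_top _ one_le_two hμt.ne),
    ← integral_inner (integrableOn_Lp_of_measure_ne_top _ one_le_two hμt.ne)]
  refine integral_congr_ae (ae_restrict_of_ae ?_)
  filter_upwards [hS f v, hT f v] with ω h1 h2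
  rw [h1.2, h2.2]

theorem MeasureTheory.L2.norm_sq_eq_integral {𝕜 Ω X : Type*} [RCLike 𝕜] [MeasurableSpace Ω]
    {μ : Measure Ω} [NormedAddCommGroup X] [InnerProductSpace 𝕜 X] (f : Lp X 2 μ) :
    ‖f‖ ^ 2 = ∫ ω, ‖f ω‖ ^ 2 ∂μ := by
  have h := L2.inner_def (𝕜 := 𝕜) f f
  simp_rw [inner_self_eq_norm_sq_to_K] at h
  exact_mod_cast h

end

theorem mainTheorem8 {𝕜 Ω₁ Ω₂ E F : Type*} [RCLike 𝕜]
    [MeasurableSpace Ω₁] [MeasurableSpace Ω₂]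
    (μ₁ : Measure Ω₁) (μ₂ : Measure Ω₂) [SigmaFinite μ₁] [SigmaFinite μ₂]
    [NormedAddCommGroup E] [InnerProductSpace 𝕜 E] [CompleteSpace E]
    [NormedAddCommGroup F] [InnerProductSpace 𝕜 F] [CompleteSpace F] :
    ∃ Φ : Lp (HilbertSchmidt 𝕜 E F) 2 (μ₁.prod μ₂) ≃ₗᵢ[𝕜]
        HilbertSchmidt 𝕜 (Lp E 2 μ₁) (Lp F 2 μ₂),
      (∀ (k : Lp (HilbertSchmidt 𝕜 E F) 2 (μ₁.prod μ₂)) (T : Lp E 2 μ₁ →L[𝕜] Lp F 2 μ₂),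
        IsKernelOperator k T ↔ T = HilbertSchmidt.toCLM (Φ k)) ∧
      ∀ k : Lp (HilbertSchmidt 𝕜 E F) 2 (μ₁.prod μ₂),
        ‖Φ k‖ ^ 2 = ∫ ω, ‖k ω‖ ^ 2 ∂(μ₁.prod μ₂) := by
  obtain ⟨Φ, hΦ⟩ := (isHilbertTensor_rankOneKernelL (𝕜 := 𝕜) (E := E) (F := F) (μ₁ := μ₁)
    (μ₂ := μ₂)).exists_linearIsometryEquiv HilbertSchmidt.isHilbertTensor_rankOneL
  have hker : ∀ k, IsKernelOperator k (HilbertSchmidt.toCLM (Φ k)) := fun k =>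
    isKernelOperator_of_inner_eq fun g f => by
      -- Write `⟪g, Φ(k) f⟫` as a pairing of `Φ k` with an elementary tensor, which is the image
      -- under `Φ` of the rank one kernel; then cancel the unitary.
      rw [← HilbertSchmidt.inner_mkRankOne_left, ← HilbertSchmidt.rankOneL_apply, ← hΦ,
        LinearIsometryEquiv.inner_map_map, rankOneKernelL_apply]
  refine ⟨Φ, fun k T => ⟨fun hT => hT.unique (hker k), ?_⟩, fun k => ?_⟩
  · rintro rfl
    exact hker k
  · rw [Φ.norm_map, L2.norm_sq_eq_integral (𝕜 := 𝕜)]
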